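/- Let $G=(V,E)$ be a finite undirected graph without loops, where $E\subseteq V\times V$ is the symmetric set of ordered pairs of adjacent vertices (so $|E|$ is twice the number of undirected edges), and assume $E\neq\emptyset$. Let $c\ge 2$. A density is a family $p(a,b|x,y)$ with $x,y\in V$ and $a,b\in\{1,\dots,c\}$. A projection valued measure (PVM) is a family of projections $(E_a)_{a=1}^c$ with $\sum_a E_a=1$. The set $C_{loc}$ is the convex hull of the deterministic densities $p(a,b|x,y)=1$ if $(a,b)=(f(x),g(y))$ and $0$ otherwise, with $f,g:V\to\{1,\dots,c\}$. The set $C_q$ consists of the densities $p(a,b|x,y)=\langle (E_{x,a}\otimes F_{y,b})\psi,\psi\rangle$, where $(E_{x,a})_a$ and $(F_{y,b})_b$ are PVMs on finite-dimensional Hilbert spaces $H_A$ and $H_B$ and $\psi\in H_A\otimes H_B$ is a unit vector. The set $C_{qc}$ consists of the densities $p(a,b|x,y)=\langle E_{x,a}F_{y,b}\psi,\psi\rangle$, where $(E_{x,a})_a$ and $(F_{y,b})_b$ are PVMs on a common Hilbert space $H$ with $E_{x,a}F_{y,b}=F_{y,b}E_{x,a}$ and $\psi\in H$ is a unit vector.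 For $t\in\{loc,q,qc\}$ let $C^s_t$ be the set of $p\in C_t$ that are synchronous, i.e. $p(a,b|x,x)=0$ for all $x$ and all $a\neq b$. In the $c$-colouring game $\mathrm{Hom}(G,K_c)$ the answers $a,b\in\{1,\dots,c\}$ to the questions $x,y\in V$ lose exactly if $(x,y)\in E$ and $a=b$, or $x=y$ and $a\ne b$. Let $\pi$ be the uniform distribution on $E$. The synchronous value $\omega^s_t(\mathrm{Hom}(G,K_c),\pi)$ is the supremum over $p\in C^s_t$ of the winning probability $\sum\pi(x,y)\,p(a,b|x,y)$, the sum being over all winning tuples $(x,y,a,b)$. A trace on a unital C*-algebra $\mathcal A$ is a linear functional $\tau:\mathcal A\to\mathbb C$ with $\tau(1)=1$, $\tau(a^*a)\ge 0$ and $\tau(ab)=\tau(ba)$ for all $a,b\in\mathcal A$. The graph correlation function is $$f_{G,t}(r)=\inf\Big\{\sum_{(x,y)\in E}\tau(P_xP_y)\;:\;\tau(P_x)=r\ \text{ for all }x\in V\Big\},$$ where the infimum is over all unital C*-algebras $\mathcal A$ (abelian ones if $t=loc$, finite-dimensional ones if $t=q$, arbitrary ones if $t=qc$), all traces $\tau$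 on $\mathcal A$ and all families of projections $(P_x)_{x\in V}$ in $\mathcal A$. Then for every $t\in\{loc,q,qc\}$, $$\max\Big\{1-\frac1c,\;1-\frac{2}{|E|}f_{G,t}\big(\tfrac12\big)\Big\}\;\le\;\omega^s_t(\mathrm{Hom}(G,K_c),\pi)\;\le\;1-\frac{c}{|E|}f_{G,t}\big(\tfrac1c\big).$$ Moreover, if $c=2$, then $\omega^s_t(\mathrm{Hom}(G,K_2),\pi)=1-\frac{2}{|E|}f_{G,t}\big(\tfrac12\big)$. -/

import Mathlib

open scoped ComplexOrder Kronecker Matrix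

namespace SyncGame

/-- The three types of strategies / traces: local, quantum, quantum commuting. -/
inductive StrategyType where
  | loc
  | q
  | qc

/-! ### Projection valued measures and traces -/

/-- A projection valued measure with outcome set `O`: projections summing to the identity. -/
structure IsPVM {O A : Type*} [Fintype O] [Ring A] [StarRing A] (E : O → A) : Prop where
  isStarProjection : ∀ a, IsStarProjection (E a)
  sum_eq_one : ∑ a, E a = 1

/-- A (unital, positive) trace on a unital C*-algebra. The positive elements of a C*-algebra
are exactly the elements `star a * a`. -/
structure IsTrace {A : Type*} [CStarAlgebra A] (τ : A →ₗ[ℂ] ℂ) : Prop where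
  map_one : τ 1 = 1
  nonneg : ∀ a, 0 ≤ τ (star a * a)
  mul_comm : ∀ a b, τ (a * b) = τ (b * a)

/-! ### Densities -/

/-- A table `p a b x y`, read as `p(a, b | x, y)`. -/
abbrev Density (I O : Type*) := O → O → I → I → ℝ

/-- The density of the deterministic strategy in which the players answer by `f` and `g`. -/
noncomputable def deterministic {I O : Type*} (f g : I → O) : Density I O :=
  open Classical in fun a b x y => if f x = a ∧ g y = b then 1 else 0

/-- The local densities: convex combinations (shared randomness) of deterministic ones. -/
def localDensities (I O : Type*) : Set (Density I O) :=
  convexHull ℝ {p | ∃ f g : I → O, p = deterministic f g}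

/-- The quantum densities: `p(a,b|x,y) = ⟨ψ, (E_{x,a} ⊗ F_{y,b}) ψ⟩` for PVMs on finite dimensional
Hilbert spaces `ℂ^m`, `ℂ^k` and a unit vector `ψ ∈ ℂ^m ⊗ ℂ^k`. -/
def quantumDensities (I O : Type*) [Fintype O] : Set (Density I O) :=
  {p | ∃ (m k : ℕ) (E : I → O → Matrix (Fin m) (Fin m) ℂ) (F : I → O → Matrix (Fin k) (Fin k) ℂ)
      (ψ : Fin m × Fin k → ℂ),
      (∀ x, IsPVM (E x)) ∧ (∀ y, IsPVM (F y)) ∧ star ψ ⬝ᵥ ψ = 1 ∧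
      ∀ a b x y, (p a b x y : ℂ) = star ψ ⬝ᵥ ((E x a ⊗ₖ F y b) *ᵥ ψ)}

/-- The quantum commuting densities: `p(a,b|x,y) = ⟨ψ, E_{x,a} F_{y,b} ψ⟩` for PVMs on one Hilbert
space, each `E_{x,a}` commuting with each `F_{y,b}`, and a unit vector `ψ`. Finitely many
operators and one vector generate a separable Hilbert space, so `Type` is large enough when
`I` and `O` are finite. -/
def commutingDensities (I O : Type*) [Fintype O] : Set (Density I O) :=
  {p | ∃ (H : Type) (_ : NormedAddCommGroup H) (_ : InnerProductSpace ℂ H) (_ : CompleteSpace H)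
      (E F : I → O → (H →L[ℂ] H)) (ψ : H),
      (∀ x, IsPVM (E x)) ∧ (∀ y, IsPVM (F y)) ∧
      (∀ x y a b, E x a * F y b = F y b * E x a) ∧ ‖ψ‖ = 1 ∧
      ∀ a b x y, (p a b x y : ℂ) = inner ℂ ψ ((E x a * F y b) ψ)}

/-- The set `C_t` of densities of type `t`. -/
def densities (t : StrategyType) (I O : Type*) [Fintype O] : Set (Density I O) :=
  match t with
  | .loc => localDensities I O
  | .q => quantumDensities I O
  | .qc => commutingDensities I O

/-- A density is synchronous if equal questions get equal answers. -/
def IsSynchronous {I O : Type*} (p : Density I O) : Prop :=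
  ∀ x a b, a ≠ b → p a b x x = 0

/-- The set `C_t^s` of synchronous densities of type `t`. -/
def syncDensities (t : StrategyType) (I O : Type*) [Fintype O] : Set (Density I O) :=
  {p | p ∈ densities t I O ∧ IsSynchronous p}

/-! ### Games and their values -/

/-- A nonlocal game with a common input set `I` and a common output set `O`:
`win x y a b` says that answers `a, b` to questions `x, y` win. -/
structure Game (I O : Type*) where
  win : I → I → O → O → Prop

/-- The expected value of the strategy `p` for the game with prior distribution `π`. -/
noncomputable def expectedValue {I O : Type*} [Fintype I] [Fintype O]
    (𝒢 : Game I O) (π : I → I → ℝ) (p : Density I O) : ℝ :=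
  open Classical in
  ∑ x, ∑ y, ∑ a, ∑ b, π x y * (if 𝒢.win x y a b then 1 else 0) * p a b x y

/-- The value of a game over a set `S` of densities. -/
noncomputable def valueOver {I O : Type*} [Fintype I] [Fintype O]
    (S : Set (Density I O)) (𝒢 : Game I O) (π : I → I → ℝ) : ℝ :=
  sSup (expectedValue 𝒢 π '' S)

/-- The synchronous value `ω^s_t`. -/
noncomputable def syncValue {I O : Type*} [Fintype I] [Fintype O]
    (t : StrategyType) (𝒢 : Game I O) (π : I → I → ℝ) : ℝ :=
  valueOver (syncDensities t I O) 𝒢 π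

/-- The graph homomorphism game `Hom(G₁, G₂)`: a 4-tuple loses iff adjacent questions receive
non-adjacent answers, or equal questions receive different answers. -/
def homGame {V W : Type*} (G₁ : SimpleGraph V) (G₂ : SimpleGraph W) : Game V W where
  win x y a b := ¬ ((G₁.Adj x y ∧ ¬ G₂.Adj a b) ∨ (x = y ∧ a ≠ b))

/-- The `c`-colouring game `Hom(G, K_c)`. -/
def colouringGame {V : Type*} (G : SimpleGraph V) (c : ℕ) : Game V (Fin c) :=
  homGame G (⊤ : SimpleGraph (Fin c))

/-- The edge set `E ⊆ V × V`, consisting of ordered pairs: every undirected edge counts twice. -/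
noncomputable def edgePairs {V : Type*} [Fintype V] (G : SimpleGraph V) : Finset (V × V) :=
  open Classical in Finset.univ.filter fun e => G.Adj e.1 e.2

/-- The uniform distribution on `E`. -/
noncomputable def uniformOnEdges {V : Type*} [Fintype V] (G : SimpleGraph V) : V → V → ℝ :=
  open Classical in fun x y => if (x, y) ∈ edgePairs G then 1 / ((edgePairs G).card : ℝ) else 0

/-! ### The graph correlation function -/

/-- The C*-algebras whose traces are the traces of type `t`: abelian ones for `loc`, finite
dimensional ones for `q`, all of them for `qc`. -/
def AlgebraOfType (t : StrategyType) (A : Type*) [CStarAlgebra A] : Prop :=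
  match t with
  | .loc => ∀ a b : A, a * b = b * a
  | .q => FiniteDimensional ℂ A
  | .qc => True

/-- The correlations `∑_{(x,y) ∈ E} τ(P_x P_y)` of all families of projections `P_x` with
`τ(P_x) = r` for every vertex `x`, in all unital C*-algebras with a trace of type `t`. A finite
family of projections generates a separable C*-algebra, so `Type` is large enough. -/
def correlationSet {V : Type*} [Fintype V] (G : SimpleGraph V) (t : StrategyType) (r : ℝ) :
    Set ℝ :=
  {s | ∃ (A : Type) (_ : CStarAlgebra A) (τ : A →ₗ[ℂ] ℂ) (P : V → A),
      AlgebraOfType t A ∧ IsTrace τ ∧ (∀ x, IsStarProjection (P x)) ∧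
      (∀ x, τ (P x) = (r : ℂ)) ∧ (s : ℂ) = ∑ e ∈ edgePairs G, τ (P e.1 * P e.2)}

/-- The graph correlation function `f_{G,t}(r)`. -/
noncomputable def graphCorrelation {V : Type*} [Fintype V] (G : SimpleGraph V)
    (t : StrategyType) (r : ℝ) : ℝ :=
  sInf (correlationSet G t r)

end SyncGame

/-! The theorem rests on a correspondence: synchronous densities of type t are exactly those of the
form `τ (E x a * E y b)`, with `τ` a trace on a C*-algebra of type t and `E x` PVMs
(`isTracial_of_mem_syncDensities`, `traceDensity_mem_syncDensities`).

From densities to traces: synchronicity forces `E x a ψ = F x a ψ`, which makes the vector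
functional of `ψ` tracial on the algebra generated by the `E x a`; in the local case it forces the
two answer functions to agree wherever the weight is nonzero. From traces to densities: for qc, let
the players multiply from the left and from the right on the GNS space; for q, write `τ` as a matrix
trace against `k * k` with `k` central and use the vectorised `k` as state; for loc, decompose the
unit into joint projections.

The value is then governed by `lossSum`, the sum over edges of the probabilities of equal answers.
Viewing `(E x a)_a` as one projection in `Fin c → A` with the averaged trace gives trace 1/c and
correlation `lossSum / c`, hence the upper bound. Conversely, projections of trace 1/2 give PVMs
`(P, 1 - P, 0, ..., 0)` with loss twice their correlation; a random colouring gives 1 - 1/c. For c =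
2 the correlation bounds coincide. -/

namespace SyncGame

/-! ### Traces on C*-algebras -/

section Traces

variable {A : Type*} [CStarAlgebra A] {τ : A →ₗ[ℂ] ℂ}

/-- A trace as a positive linear functional. -/
noncomputable def IsTrace.toPositive [PartialOrder A] [StarOrderedRing A] (hτ : IsTrace τ) :
    A →ₚ[ℂ] ℂ :=
  PositiveLinearMap.mk₀ τ fun x hx => by
    obtain ⟨b, rfl⟩ := CStarAlgebra.nonneg_iff_eq_star_mul_self.mp hx
    exact hτ.nonneg b

lemma IsTrace.map_star (hτ : IsTrace τ) (a : A) : τ (star a) = star (τ a) := by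
  let _ := CStarAlgebra.spectralOrder A
  have _ := CStarAlgebra.spectralOrderedRing A
  exact StarHomClass.map_star hτ.toPositive a

/-- Traciality and idempotence identify `τ (p * q)` with the value of `τ` at `star (p * q) * (p *
q)`. -/
lemma IsTrace.mul_nonneg (hτ : IsTrace τ) {p q : A} (hp : IsStarProjection p)
    (hq : IsStarProjection q) : 0 ≤ τ (p * q) := by
  have h : τ (star (p * q) * (p * q)) = τ (p * q) := by
    rw [star_mul, hp.isSelfAdjoint.star_eq, hq.isSelfAdjoint.star_eq, mul_assoc, hτ.mul_comm,
      ← mul_assoc p p q, hp.isIdempotentElem.eq, mul_assoc, hq.isIdempotentElem.eq]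
  exact h ▸ hτ.nonneg (p * q)

/-- A nonnegative complex number is the cast of its real part. -/
lemma ofReal_re_of_nonneg {z : ℂ} (hz : 0 ≤ z) : ((z.re : ℝ) : ℂ) = z :=
  (Complex.eq_re_of_ofReal_le (r := 0) (by simpa using hz)).symm

end Traces

section PVM

variable {O A B : Type*} [Fintype O] [Ring A] [StarRing A] [Ring B] [StarRing B]

lemma IsPVM.map {F : Type*} [FunLike F A B] [RingHomClass F A B] [StarHomClass F A B]
    {E : O → A} (hE : IsPVM E) (φ : F) : IsPVM fun a => φ (E a) where
  isStarProjection a := (hE.isStarProjection a).map φ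
  sum_eq_one := by rw [← map_sum, hE.sum_eq_one, map_one]

end PVM

/-- Projections of a PVM are mutually orthogonal with respect to a trace. -/
lemma IsTrace.mul_eq_zero_of_ne {O A : Type*} [Fintype O] [CStarAlgebra A] {τ : A →ₗ[ℂ] ℂ}
    (hτ : IsTrace τ) {E : O → A} (hE : IsPVM E) {a b : O} (hab : a ≠ b) :
    τ (E a * E b) = 0 := by
  classical
  have h : ∑ d, τ (E a * E d) = τ (E a * E a) := by
    rw [← map_sum, ← Finset.mul_sum, hE.sum_eq_one, mul_one,
      (hE.isStarProjection a).isIdempotentElem.eq]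
  rw [← Finset.add_sum_erase _ _ (Finset.mem_univ a), add_eq_left,
    Finset.sum_eq_zero_iff_of_nonneg fun d _ =>
      hτ.mul_nonneg (hE.isStarProjection a) (hE.isStarProjection d)] at h
  exact h b (Finset.mem_erase.mpr ⟨hab.symm, Finset.mem_univ _⟩)

/-- The density `p(a,b|x,y) = τ(E_{x,a} E_{y,b})` given by a trace and a family of PVMs. -/
noncomputable def traceDensity {I O A : Type*} [CStarAlgebra A] (τ : A →ₗ[ℂ] ℂ) (E : I → O → A) :
    Density I O :=
  fun a b x y => (τ (E x a * E y b)).re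

section TraceDensity

variable {I O A : Type*} [Fintype O] [CStarAlgebra A] {τ : A →ₗ[ℂ] ℂ} {E : I → O → A}

lemma IsTrace.coe_traceDensity (hτ : IsTrace τ) (hE : ∀ x, IsPVM (E x)) (a b : O) (x y : I) :
    (traceDensity τ E a b x y : ℂ) = τ (E x a * E y b) :=
  ofReal_re_of_nonneg
    (hτ.mul_nonneg ((hE x).isStarProjection a) ((hE y).isStarProjection b))

lemma IsTrace.isSynchronous_traceDensity (hτ : IsTrace τ) (hE : ∀ x, IsPVM (E x)) :
    IsSynchronous (traceDensity τ E) := fun x a b hab => by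
  simp [traceDensity, hτ.mul_eq_zero_of_ne (hE x) hab]

end TraceDensity

/-! ### The GNS representation of a trace -/

section GNS

open PositiveLinearMap ContinuousLinearMap UniformSpace Completion

variable {A : Type*} [CStarAlgebra A] [PartialOrder A] [StarOrderedRing A] {f : A →ₚ[ℂ] ℂ}

/-- Right multiplication on the GNS space of a tracial positive functional. -/
noncomputable def rightMulPreGNS (hf : ∀ a b, f (a * b) = f (b * a)) (a : A) :
    f.PreGNS →L[ℂ] f.PreGNS :=
  f.toPreGNS.toLinearMap ∘ₗ LinearMap.mulRight ℂ a ∘ₗ f.ofPreGNS.toLinearMap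
    |>.mkContinuous ‖a‖ fun x ↦ by
    rw [← sq_le_sq₀ (by positivity) (by positivity), mul_pow, ← RCLike.ofReal_le_ofReal (K := ℂ),
      RCLike.ofReal_pow, RCLike.ofReal_eq_complex_ofReal, preGNS_norm_sq]
    -- Traciality puts `a * star a` in the middle, where it is bounded by `‖a‖ ^ 2`.
    have h : f.ofPreGNS x * a * star (f.ofPreGNS x * a) ≤
        ‖a‖ ^ 2 • (f.ofPreGNS x * star (f.ofPreGNS x)) := by
      have := CStarAlgebra.star_right_conjugate_le_norm_smul (a := f.ofPreGNS x)
        (b := a * star a)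
      rwa [CStarRing.norm_self_mul_star, ← sq, ← mul_assoc, mul_assoc, ← star_mul] at this
    calc f (star (f.ofPreGNS x * a) * (f.ofPreGNS x * a))
        = f (f.ofPreGNS x * a * star (f.ofPreGNS x * a)) := hf _ _
      _ ≤ f (‖a‖ ^ 2 • (f.ofPreGNS x * star (f.ofPreGNS x))) := OrderHomClass.mono f h
      _ = _ := by simp [← Complex.coe_smul, preGNS_norm_sq, hf (f.ofPreGNS x)]

lemma rightMulPreGNS_apply (hf : ∀ a b, f (a * b) = f (b * a)) (a : A) (x : f.PreGNS) :
    rightMulPreGNS hf a x = f.toPreGNS (f.ofPreGNS x * a) := rfl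

/-- Right multiplication on the GNS Hilbert space of a tracial positive functional. -/
noncomputable def gnsRightMul (hf : ∀ a b, f (a * b) = f (b * a)) (a : A) :
    f.GNS →L[ℂ] f.GNS :=
  (rightMulPreGNS hf a).completion

@[simp]
lemma gnsRightMul_coe (hf : ∀ a b, f (a * b) = f (b * a)) (a : A) (x : f.PreGNS) :
    gnsRightMul hf a x = (f.toPreGNS (f.ofPreGNS x * a) : f.PreGNS) := by
  simp [gnsRightMul, rightMulPreGNS_apply]

lemma gnsRightMul_mul (hf : ∀ a b, f (a * b) = f (b * a)) (a b : A) :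
    gnsRightMul hf (a * b) = gnsRightMul hf b * gnsRightMul hf a := by
  ext c
  induction c using induction_on with
  | hp => apply isClosed_eq <;> fun_prop
  | ih c => simp [mul_assoc]

lemma gnsRightMul_add (hf : ∀ a b, f (a * b) = f (b * a)) (a b : A) :
    gnsRightMul hf (a + b) = gnsRightMul hf a + gnsRightMul hf b := by
  ext c
  induction c using induction_on with
  | hp => apply isClosed_eq <;> fun_prop
  | ih c => simp [mul_add, Completion.coe_add]

lemma gnsRightMul_one (hf : ∀ a b, f (a * b) = f (b * a)) : gnsRightMul hf 1 = 1 := by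
  ext c
  induction c using induction_on with
  | hp => apply isClosed_eq <;> fun_prop
  | ih c => simp

/-- On the dense subspace this is the trace identity `f (a * (star x * y)) = f (star x * y * a)`. -/
lemma gnsRightMul_star (hf : ∀ a b, f (a * b) = f (b * a)) (a : A) :
    gnsRightMul hf (star a) = star (gnsRightMul hf a) := by
  refine (eq_adjoint_iff _ _).mpr fun x y => ?_
  induction x, y using induction_on₂ with
  | hp => apply isClosed_eq <;> fun_prop
  | ih x y =>
    simp only [gnsRightMul_coe, inner_coe, preGNS_inner_def, ofPreGNS_toPreGNS, star_mul,
      star_star]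
    rw [mul_assoc, hf, mul_assoc]

/-- Right multiplication reverses products, so `IsPVM.map` does not apply; squares, adjoints and
sums are all that is needed. -/
lemma isPVM_gnsRightMul {O : Type*} [Fintype O] (hf : ∀ a b, f (a * b) = f (b * a)) {E : O → A}
    (hE : IsPVM E) : IsPVM fun a => gnsRightMul hf (E a) where
  isStarProjection a :=
    { isIdempotentElem := by
        rw [IsIdempotentElem, ← gnsRightMul_mul, (hE.isStarProjection a).isIdempotentElem.eq]
      isSelfAdjoint := by
        rw [IsSelfAdjoint, ← gnsRightMul_star, (hE.isStarProjection a).isSelfAdjoint.star_eq] }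
  sum_eq_one := by
    let φ : A →+ (f.GNS →L[ℂ] f.GNS) := AddMonoidHom.mk' (gnsRightMul hf) (gnsRightMul_add hf)
    rw [← gnsRightMul_one hf, ← hE.sum_eq_one]
    exact (map_sum φ E Finset.univ).symm

lemma gnsStarAlgHom_comm_gnsRightMul (hf : ∀ a b, f (a * b) = f (b * a)) (a b : A) :
    f.gnsStarAlgHom a * gnsRightMul hf b = gnsRightMul hf b * f.gnsStarAlgHom a := by
  ext c
  induction c using induction_on with
  | hp => apply isClosed_eq <;> fun_prop
  | ih c => simp [mul_assoc]

/-- The cyclic vector of the GNS representation. -/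
noncomputable def gnsVector (f : A →ₚ[ℂ] ℂ) : f.GNS := (f.toPreGNS 1 : f.PreGNS)

lemma gnsStarAlgHom_gnsVector (a : A) :
    f.gnsStarAlgHom a (gnsVector f) = (f.toPreGNS a : f.PreGNS) := by
  simp [gnsVector]

lemma inner_gnsVector_coe (a : A) :
    inner ℂ (gnsVector f) ((f.toPreGNS a : f.PreGNS) : f.GNS) = f a := by
  simp [gnsVector, preGNS_inner_def]

lemma norm_gnsVector (h : f 1 = 1) : ‖gnsVector f‖ = 1 := by
  simp [gnsVector, preGNS_norm_def, h]

end GNS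

/-- Traces on arbitrary C*-algebras give quantum commuting densities. -/
lemma traceDensity_mem_commutingDensities {I O : Type*} [Fintype O] {A : Type} [CStarAlgebra A]
    {τ : A →ₗ[ℂ] ℂ} {E : I → O → A} (hτ : IsTrace τ) (hE : ∀ x, IsPVM (E x)) :
    traceDensity τ E ∈ commutingDensities I O := by
  let _ := CStarAlgebra.spectralOrder A
  have _ := CStarAlgebra.spectralOrderedRing A
  let f := hτ.toPositive
  have hf : ∀ a b, f (a * b) = f (b * a) := hτ.mul_comm
  refine ⟨f.GNS, inferInstance, inferInstance, inferInstance, fun x a => f.gnsStarAlgHom (E x a),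
    fun y b => gnsRightMul hf (E y b), gnsVector f, fun x => (hE x).map f.gnsStarAlgHom,
    fun y => isPVM_gnsRightMul hf (hE y), fun x y a b => gnsStarAlgHom_comm_gnsRightMul hf _ _,
    norm_gnsVector hτ.map_one, fun a b x y => ?_⟩
  rw [hτ.coe_traceDensity hE, gnsStarAlgHom_comm_gnsRightMul, mul_apply_eq_comp,
    gnsStarAlgHom_gnsVector, gnsRightMul_coe, inner_gnsVector_coe]
  rfl

/-! ### Traces on finite dimensional C*-algebras -/

section DensityOperator

variable {B : Type*} [CStarAlgebra B] {n : Type*} [Fintype n] [DecidableEq n]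

/-- The trace form is nondegenerate: testing with `star (d - e)` gives the squared Hilbert-Schmidt
norm of `Φ (d - e)`. -/
lemma eq_of_trace_eq (Φ : B →⋆ₐ[ℂ] Matrix n n ℂ) (hΦ : Function.Injective Φ) {d e : B}
    (h : ∀ b, (Φ (b * d)).trace = (Φ (b * e)).trace) : d = e := by
  have h' : ((Φ (d - e))ᴴ * Φ (d - e)).trace = 0 := by
    rw [← Matrix.star_eq_conjTranspose, ← map_star, ← map_mul, mul_sub, map_sub, Matrix.trace_sub,
      h, sub_self]
  have := Matrix.trace_conjTranspose_mul_self_eq_zero_iff.mp h'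
  exact sub_eq_zero.mp (hΦ (by simpa using this))

variable [FiniteDimensional ℂ B]

/-- Every functional on a finite dimensional C*-algebra of matrices is represented by an element
of the algebra. -/
lemma exists_density (Φ : B →⋆ₐ[ℂ] Matrix n n ℂ) (hΦ : Function.Injective Φ) (τ : B →ₗ[ℂ] ℂ) :
    ∃ d : B, ∀ b, τ b = (Φ (b * d)).trace := by
  let T : B →ₗ[ℂ] Module.Dual ℂ B :=
    LinearMap.mk₂ ℂ (fun d b => (Φ (b * d)).trace) (by simp [mul_add]) (by simp) (by simp [add_mul])
      (by simp)
  have hT : Function.Injective T := by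
    refine (injective_iff_map_eq_zero T).mpr fun d hd => ?_
    have h : ((Φ d)ᴴ * Φ d).trace = 0 := by
      have := LinearMap.congr_fun hd (star d)
      simpa [T, map_star, Matrix.star_eq_conjTranspose] using this
    exact hΦ (by simpa using Matrix.trace_conjTranspose_mul_self_eq_zero_iff.mp h)
  obtain ⟨d, hd⟩ := (LinearMap.injective_iff_surjective_of_finrank_eq_finrank
    (Subspace.dual_finrank_eq (K := ℂ) (V := B)).symm).mp hT τ
  exact ⟨d, fun b => (LinearMap.congr_fun hd b).symm⟩

/-- A trace on a finite dimensional C*-algebra of matrices is given by the square of a self-adjoint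
central element. -/
lemma exists_central_sqrt_density (Φ : B →⋆ₐ[ℂ] Matrix n n ℂ) (hΦ : Function.Injective Φ)
    {τ : B →ₗ[ℂ] ℂ} (hτ : IsTrace τ) :
    ∃ k : B, IsSelfAdjoint k ∧ (∀ b, Commute k b) ∧ ∀ b, τ b = (Φ (b * (k * k))).trace := by
  let _ := CStarAlgebra.spectralOrder B
  have _ := CStarAlgebra.spectralOrderedRing B
  obtain ⟨d, hd⟩ := exists_density Φ hΦ τ
  have hsa : IsSelfAdjoint d := by
    refine eq_of_trace_eq Φ hΦ fun b => ?_
    rw [← hd, map_mul, map_star, Matrix.star_eq_conjTranspose, ← Matrix.trace_mul_comm]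
    have := hτ.map_star (star b)
    rw [star_star, hd (star b), map_mul, map_star, Matrix.star_eq_conjTranspose,
      ← Matrix.trace_conjTranspose, Matrix.conjTranspose_mul, Matrix.conjTranspose_conjTranspose]
      at this
    exact this.symm
  have hcomm : ∀ b, Commute d b := fun b => eq_of_trace_eq Φ hΦ fun x => by
    rw [← mul_assoc, map_mul, Matrix.trace_mul_comm, ← map_mul, ← mul_assoc, ← hd, hτ.mul_comm,
      hd, mul_assoc]
  -- Evaluating `τ` at the square of the negative part `d⁻ = star s * s` gives minus the squared
  -- Hilbert-Schmidt norm of `Φ (s * d⁻)`, so positivity of `τ` forces `s * d⁻ = 0` and then `d⁻ =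
  -- 0`.
  have hnonneg : 0 ≤ d := by
    have hN := CFC.negPart_nonneg d
    have hNsa : IsSelfAdjoint d⁻ := hN.isSelfAdjoint
    obtain ⟨s, hs⟩ := CStarAlgebra.nonneg_iff_eq_star_mul_self.mp hN
    have h1 : d⁻ * d = -(d⁻ * d⁻) := by
      have := congrArg (d⁻ * ·) (CFC.posPart_sub_negPart d hsa)
      simpa [mul_sub] using this.symm
    have h2 : 0 ≤ -((Φ (s * d⁻))ᴴ * Φ (s * d⁻)).trace := by
      have := hτ.nonneg d⁻
      rw [hNsa.star_eq, hd, mul_assoc, h1, mul_neg, map_neg, Matrix.trace_neg] at this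
      rw [← Matrix.star_eq_conjTranspose, ← map_star, ← map_mul, star_mul, hNsa.star_eq]
      rwa [mul_assoc, ← mul_assoc (star s), ← hs]
    have h3 : 0 ≤ ((Φ (s * d⁻))ᴴ * Φ (s * d⁻)).trace :=
      (Matrix.posSemidef_conjTranspose_mul_self _).trace_nonneg
    have h4 : s * d⁻ = 0 := hΦ (by
      simpa using Matrix.trace_conjTranspose_mul_self_eq_zero_iff.mp
        (le_antisymm (neg_nonneg.mp h2) h3))
    have h5 : star d⁻ * d⁻ = 0 := by
      rw [hNsa.star_eq]
      nth_rw 1 [hs]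
      rw [mul_assoc, h4, mul_zero]
    exact (CFC.negPart_eq_zero_iff d hsa).mp (CStarRing.star_mul_self_eq_zero_iff _ |>.mp h5)
  refine ⟨CFC.sqrt d, (CFC.sqrt_nonneg d).isSelfAdjoint, fun b => ?_, fun b => ?_⟩
  · rw [CFC.sqrt_eq_cfc]
    exact (hcomm b).cfc_nnreal _
  · rw [CFC.sqrt_mul_sqrt_self d hnonneg, hd]

end DensityOperator

lemma IsPVM.transpose {O n : Type*} [Fintype O] [Fintype n] [DecidableEq n]
    {E : O → Matrix n n ℂ} (hE : IsPVM E) : IsPVM fun a => (E a)ᵀ where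
  isStarProjection a :=
    { isIdempotentElem := by
        rw [IsIdempotentElem, ← Matrix.transpose_mul, (hE.isStarProjection a).isIdempotentElem.eq]
      isSelfAdjoint := by
        have := (hE.isStarProjection a).isSelfAdjoint.star_eq
        rw [Matrix.star_eq_conjTranspose] at this
        change ((E a)ᴴ)ᵀ = (E a)ᵀ
        rw [this] }
  sum_eq_one := by rw [← Matrix.transpose_sum, hE.sum_eq_one, Matrix.transpose_one]

/-- With the vectorised transpose of `Φ k` as state and transposed operators for the second player,
the density is the trace of `Φ (E x a * k * E y b * k)`, and centrality of `k` collects the factor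
`k * k`. -/
lemma traceDensity_mem_quantumDensities_of_matrix {I O B : Type*} [Fintype O] [CStarAlgebra B]
    [FiniteDimensional ℂ B] {n : ℕ} (Φ : B →⋆ₐ[ℂ] Matrix (Fin n) (Fin n) ℂ)
    (hΦ : Function.Injective Φ) {τ : B →ₗ[ℂ] ℂ} {E : I → O → B} (hτ : IsTrace τ)
    (hE : ∀ x, IsPVM (E x)) : traceDensity τ E ∈ quantumDensities I O := by
  obtain ⟨k, hk, hcomm, htr⟩ := exists_central_sqrt_density Φ hΦ hτ
  have hK : ((Φ k)ᵀ)ᴴ = (Φ k)ᵀ := by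
    change ((Φ k)ᴴ)ᵀ = (Φ k)ᵀ
    rw [← Matrix.star_eq_conjTranspose, ← map_star, hk.star_eq]
  refine ⟨n, n, fun x a => Φ (E x a), fun y b => (Φ (E y b))ᵀ, Matrix.vec (Φ k)ᵀ,
    fun x => (hE x).map Φ, fun y => ((hE y).map Φ).transpose, ?_, fun a b x y => ?_⟩
  · rw [Matrix.star_vec_dotProduct_vec, hK, ← Matrix.transpose_mul, Matrix.trace_transpose,
      ← map_mul, ← hτ.map_one, htr, one_mul]
  · rw [hτ.coe_traceDensity hE, Matrix.kronecker_mulVec_vec, Matrix.star_vec_dotProduct_vec, hK,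
      ← Matrix.transpose_mul, ← Matrix.transpose_mul, ← Matrix.transpose_mul,
      Matrix.trace_transpose, ← map_mul, ← map_mul, ← map_mul, htr]
    congr 2
    rw [mul_assoc, mul_assoc, mul_assoc, ← mul_assoc k (E y b), (hcomm (E y b)).eq, mul_assoc]

/-- The vector functional of `ξ`. -/
noncomputable def vectorFunctional {H : Type*} [NormedAddCommGroup H] [InnerProductSpace ℂ H]
    (ξ : H) : (H →L[ℂ] H) →L[ℂ] ℂ :=
  (innerSL ℂ ξ).comp (ContinuousLinearMap.apply ℂ H ξ)

@[simp]
lemma vectorFunctional_apply {H : Type*} [NormedAddCommGroup H] [InnerProductSpace ℂ H]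
    (ξ : H) (T : H →L[ℂ] H) : vectorFunctional ξ T = inner ℂ ξ (T ξ) := rfl

lemma isTrace_vectorFunctional {H : Type*} [NormedAddCommGroup H] [InnerProductSpace ℂ H]
    [CompleteSpace H] (S : StarSubalgebra ℂ (H →L[ℂ] H)) [IsClosed (S : Set (H →L[ℂ] H))] {ξ : H}
    (hξ : ‖ξ‖ = 1)
    (h : ∀ X ∈ S, ∀ Y ∈ S, vectorFunctional ξ (X * Y) = vectorFunctional ξ (Y * X)) :
    IsTrace (A := S) ((vectorFunctional ξ).toLinearMap ∘ₗ S.toSubalgebra.val.toLinearMap) where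
  map_one := by simp [hξ]
  nonneg a := by
    have : vectorFunctional ξ (star (a : H →L[ℂ] H) * a) = (‖(a : H →L[ℂ] H) ξ‖ ^ 2 : ℝ) := by
      rw [vectorFunctional_apply, mul_apply_eq_comp,
        ContinuousLinearMap.star_eq_adjoint, ContinuousLinearMap.adjoint_inner_right,
        inner_self_eq_norm_sq_to_K]
      simp
    change 0 ≤ vectorFunctional ξ (star (a : H →L[ℂ] H) * a)
    rw [this]
    exact_mod_cast sq_nonneg ‖(a : H →L[ℂ] H) ξ‖
  mul_comm a b := h a a.2 b b.2

/-- Bounded operators on a finite dimensional Hilbert space are matrices. -/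
noncomputable def toMatrixStarAlgEquiv (H : Type*) [NormedAddCommGroup H] [InnerProductSpace ℂ H]
    [FiniteDimensional ℂ H] [CompleteSpace H] :
    (H →L[ℂ] H) ≃⋆ₐ[ℂ] Matrix (Fin (Module.finrank ℂ H)) (Fin (Module.finrank ℂ H)) ℂ :=
  StarAlgEquiv.trans
    (StarAlgEquiv.symm
      { LinearMap.toContinuousLinearMap (𝕜 := ℂ) (E := H) (F' := H) with
        map_mul' := fun _ _ ↦ rfl
        map_star' := LinearMap.adjoint_toContinuousLinearMap })
    (LinearMap.toMatrixOrthonormal (stdOrthonormalBasis ℂ H))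

/-- The image of `A` is dense in the completion and, being finite dimensional, also closed. -/
instance finiteDimensional_gns {A : Type*} [CStarAlgebra A] [PartialOrder A] [StarOrderedRing A]
    [FiniteDimensional ℂ A] (f : A →ₚ[ℂ] ℂ) : FiniteDimensional ℂ f.GNS := by
  let ι : A →ₗ[ℂ] f.GNS :=
    (UniformSpace.Completion.toComplₗᵢ (𝕜 := ℂ) (E := f.PreGNS)).toLinearMap ∘ₗ
      f.toPreGNS.toLinearMap
  have hd : Dense (LinearMap.range ι : Set f.GNS) := by
    refine UniformSpace.Completion.denseRange_coe.mono ?_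
    rintro _ ⟨x, rfl⟩
    exact ⟨f.ofPreGNS x, rfl⟩
  have hc : IsClosed (LinearMap.range ι : Set f.GNS) := Submodule.closed_of_finiteDimensional _
  have : LinearMap.range ι = ⊤ := SetLike.coe_injective (hc.closure_eq ▸ hd.closure_eq)
  exact Module.Finite.of_surjective ι (LinearMap.range_eq_top.mp this)

/-- Traces on finite dimensional C*-algebras give quantum densities. -/
lemma traceDensity_mem_quantumDensities {I O A : Type*} [Fintype O] [CStarAlgebra A]
    [FiniteDimensional ℂ A] {τ : A →ₗ[ℂ] ℂ} {E : I → O → A} (hτ : IsTrace τ)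
    (hE : ∀ x, IsPVM (E x)) : traceDensity τ E ∈ quantumDensities I O := by
  let _ := CStarAlgebra.spectralOrder A
  have _ := CStarAlgebra.spectralOrderedRing A
  let f := hτ.toPositive
  -- Passing to the GNS image provides an injective matrix representation, even when `τ` is not
  -- faithful.
  let S := f.gnsStarAlgHom.range
  have hfS : FiniteDimensional ℂ S := inferInstanceAs (FiniteDimensional ℂ S.toSubalgebra)
  have hS : IsClosed (S : Set (f.GNS →L[ℂ] f.GNS)) :=
    Submodule.closed_of_finiteDimensional (Subalgebra.toSubmodule S.toSubalgebra)
  have hval : ∀ a, vectorFunctional (gnsVector f) (f.gnsStarAlgHom a) = τ a := fun a => by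
    rw [vectorFunctional_apply, gnsStarAlgHom_gnsVector, inner_gnsVector_coe]
    rfl
  have htr : IsTrace (A := S) _ := isTrace_vectorFunctional S (norm_gnsVector hτ.map_one) (by
    rintro _ ⟨a, rfl⟩ _ ⟨b, rfl⟩
    change vectorFunctional (gnsVector f) (f.gnsStarAlgHom a * f.gnsStarAlgHom b) =
      vectorFunctional (gnsVector f) (f.gnsStarAlgHom b * f.gnsStarAlgHom a)
    rw [← map_mul, ← map_mul, hval, hval, hτ.mul_comm])
  let Φ : S →⋆ₐ[ℂ] _ := (toMatrixStarAlgEquiv f.GNS).toStarAlgHom.comp S.subtype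
  have hΦ : Function.Injective Φ :=
    (toMatrixStarAlgEquiv f.GNS).injective.comp Subtype.coe_injective
  have := traceDensity_mem_quantumDensities_of_matrix Φ hΦ htr
    (E := fun x a => f.gnsStarAlgHom.rangeRestrict (E x a))
    fun x => (hE x).map f.gnsStarAlgHom.rangeRestrict
  convert this using 1
  funext a b x y
  change (τ _).re = (vectorFunctional (gnsVector f)
    (f.gnsStarAlgHom (E x a) * f.gnsStarAlgHom (E y b))).re
  rw [← map_mul, hval]

/-! ### Synchronous densities come from traces -/

/-- `p` is the density of a family of PVMs in a C*-algebra of type `t` with a trace. -/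
def IsTracial {I O : Type*} [Fintype O] (t : StrategyType) (p : Density I O) : Prop :=
  ∃ (A : Type) (_ : CStarAlgebra A) (τ : A →ₗ[ℂ] ℂ) (E : I → O → A),
    AlgebraOfType t A ∧ IsTrace τ ∧ (∀ x, IsPVM (E x)) ∧
      ∀ a b x y, (p a b x y : ℂ) = τ (E x a * E y b)

section Commuting

variable {I O H : Type*} [NormedAddCommGroup H] [InnerProductSpace ℂ H] [CompleteSpace H]
  {E F : I → O → (H →L[ℂ] H)} {ψ : H}

/-- The C*-algebra generated by a family of operators. -/
noncomputable def generatedAlgebra (E : I → O → (H →L[ℂ] H)) : StarSubalgebra ℂ (H →L[ℂ] H) :=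
  (StarAlgebra.adjoin ℂ {T | ∃ x a, T = E x a}).topologicalClosure

lemma mem_generatedAlgebra (x : I) (a : O) : E x a ∈ generatedAlgebra E :=
  StarSubalgebra.le_topologicalClosure _ (StarAlgebra.subset_adjoin ℂ _ ⟨x, a, rfl⟩)

instance isClosed_generatedAlgebra : IsClosed (generatedAlgebra E : Set (H →L[ℂ] H)) :=
  StarSubalgebra.isClosed_topologicalClosure _

/-- The centralizer of a self-adjoint `T` is a closed star subalgebra containing the generators. -/
lemma commute_of_mem_generatedAlgebra {T : H →L[ℂ] H} (hT : IsSelfAdjoint T)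
    (h : ∀ x a, E x a * T = T * E x a) {X : H →L[ℂ] H} (hX : X ∈ generatedAlgebra E) :
    X * T = T * X := by
  have hle : generatedAlgebra E ≤ StarSubalgebra.centralizer ℂ {T} := by
    refine StarSubalgebra.topologicalClosure_minimal (StarAlgebra.adjoin_le ?_)
      (Set.isClosed_centralizer _)
    rintro _ ⟨x, a, rfl⟩
    exact (StarSubalgebra.mem_centralizer_iff ℂ).mpr fun S hS => by simp_all [hT.star_eq]
  exact ((StarSubalgebra.mem_centralizer_iff ℂ).mp (hle hX) T rfl).1.symm

variable [Fintype O]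

/-- `P * Q` is itself a projection, so the inner product is `‖(P * Q) ψ‖ ^ 2`. -/
lemma mul_apply_eq_zero_of_inner_eq_zero {P Q : H →L[ℂ] H} (hP : IsStarProjection P)
    (hQ : IsStarProjection Q) (hc : P * Q = Q * P) (h : inner ℂ ψ ((P * Q) ψ) = 0) :
    (P * Q) ψ = 0 := by
  have hPQ : IsStarProjection (P * Q) := hP.mul hQ hc
  have hsa := hPQ.isSelfAdjoint.star_eq
  rw [ContinuousLinearMap.star_eq_adjoint] at hsa
  rw [← inner_self_eq_zero (𝕜 := ℂ)]
  nth_rw 1 [← hsa]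
  rwa [ContinuousLinearMap.adjoint_inner_left, ← mul_apply_eq_comp,
    hPQ.isIdempotentElem.eq]

/-- In a synchronous commuting strategy both players' operators act in the same way on the
state. -/
lemma apply_eq_of_synchronous (hE : ∀ x, IsPVM (E x)) (hF : ∀ y, IsPVM (F y))
    (hEF : ∀ x y a b, E x a * F y b = F y b * E x a)
    (hs : ∀ x a b, a ≠ b → inner ℂ ψ ((E x a * F x b) ψ) = 0) (x : I) (a : O) :
    E x a ψ = F x a ψ := by
  classical
  have h0 : ∀ a b, a ≠ b → (E x a * F x b) ψ = 0 := fun a b hab =>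
    mul_apply_eq_zero_of_inner_eq_zero ((hE x).isStarProjection a) ((hF x).isStarProjection b)
      (hEF x x a b) (hs x a b hab)
  have h1 : E x a ψ = (E x a * F x a) ψ := by
    have : E x a ψ = ∑ b, (E x a * F x b) ψ := by
      rw [← sum_apply, ← Finset.mul_sum, (hF x).sum_eq_one, mul_one]
    rw [this, Finset.sum_eq_single a (fun b _ hb => h0 a b hb.symm) (by simp)]
  have h2 : F x a ψ = (E x a * F x a) ψ := by
    have : F x a ψ = ∑ b, (E x b * F x a) ψ := by
      rw [← sum_apply, ← Finset.sum_mul, (hE x).sum_eq_one, one_mul]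
    rw [this, Finset.sum_eq_single a (fun b _ hb => h0 b a hb) (by simp)]
  rw [h1, h2]

/-- A generator `E x a` next to `ψ` can be exchanged for `F x a`, which commutes past `X`, moves
across the inner product and turns back into `E x a`. The identity then extends to products,
adjoints and limits. -/
lemma vectorFunctional_mul_comm (hE : ∀ x, IsPVM (E x)) (hF : ∀ y, IsPVM (F y))
    (hEF : ∀ x y a b, E x a * F y b = F y b * E x a) (hψ : ∀ x a, E x a ψ = F x a ψ)
    {X Y : H →L[ℂ] H} (hX : X ∈ generatedAlgebra E) (hY : Y ∈ generatedAlgebra E) :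
    vectorFunctional ψ (X * Y) = vectorFunctional ψ (Y * X) := by
  have hstar : ∀ T : H →L[ℂ] H, vectorFunctional ψ (star T) = star (vectorFunctional ψ T) := by
    intro T
    simp [ContinuousLinearMap.star_eq_adjoint, ContinuousLinearMap.adjoint_inner_right]
  -- The quantifier over `X` stays inside the set: the product case applies the hypotheses to `X *
  -- Y` and `Z * X`.
  suffices h : closure (StarAlgebra.adjoin ℂ {T | ∃ x a, T = E x a} : Set (H →L[ℂ] H)) ⊆
      {Y | ∀ X ∈ generatedAlgebra E, vectorFunctional ψ (X * Y) = vectorFunctional ψ (Y * X)} from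
    h hY X hX
  refine closure_minimal (fun Y hY => ?_) ?_
  · induction hY using StarAlgebra.adjoin_induction with
    | mem T hT =>
      obtain ⟨x, a, rfl⟩ := hT
      intro X hX
      have hXF : X * F x a = F x a * X := commute_of_mem_generatedAlgebra
        ((hF x).isStarProjection a).isSelfAdjoint (fun y b => hEF y x b a) hX
      have hE' := ((hE x).isStarProjection a).isSelfAdjoint.star_eq
      have hF' := ((hF x).isStarProjection a).isSelfAdjoint.star_eq
      rw [ContinuousLinearMap.star_eq_adjoint] at hE' hF'
      calc vectorFunctional ψ (X * E x a) = inner ℂ ψ ((X * F x a) ψ) := by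
            simp [mul_apply_eq_comp, hψ]
        _ = inner ℂ (E x a ψ) (X ψ) := by
            rw [hXF, mul_apply_eq_comp, hψ, ← ContinuousLinearMap.adjoint_inner_left, hF']
        _ = vectorFunctional ψ (E x a * X) := by
            rw [vectorFunctional_apply, mul_apply_eq_comp,
              ← ContinuousLinearMap.adjoint_inner_left (E x a), hE']
    | algebraMap r => intro X _; rw [Algebra.commutes]
    | add Y Z _ _ hY hZ => intro X hX; rw [mul_add, add_mul, map_add, map_add, hY X hX, hZ X hX]
    | mul Y Z hYm hZm hY hZ =>
      intro X hX
      have hYm := StarSubalgebra.le_topologicalClosure _ hYm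
      have hZm := StarSubalgebra.le_topologicalClosure _ hZm
      rw [← mul_assoc, hZ _ (mul_mem hX hYm), ← mul_assoc, hY _ (mul_mem hZm hX), mul_assoc]
    | star Y _ hY =>
      intro X hX
      have := congrArg star (hY (star X) (star_mem hX))
      rw [← hstar, ← hstar, star_mul, star_mul, star_star] at this
      exact this.symm
  · simp only [Set.ofPred_forall]
    refine isClosed_iInter fun X => isClosed_iInter fun _ => isClosed_eq ?_ ?_
    · exact (vectorFunctional ψ).continuous.comp (continuous_const.mul continuous_id)
    · exact (vectorFunctional ψ).continuous.comp (continuous_id.mul continuous_const)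

end Commuting

/-- A synchronous commuting strategy is given by a trace on an algebra of operators. -/
lemma isTracial_of_commuting {I O : Type*} [Fintype O] {H : Type} [NormedAddCommGroup H]
    [InnerProductSpace ℂ H] [CompleteSpace H] {E F : I → O → (H →L[ℂ] H)} {ψ : H}
    (t : StrategyType) (ht : ∀ (S : StarSubalgebra ℂ (H →L[ℂ] H))
      [IsClosed (S : Set (H →L[ℂ] H))], AlgebraOfType t S)
    (hE : ∀ x, IsPVM (E x)) (hF : ∀ y, IsPVM (F y))
    (hEF : ∀ x y a b, E x a * F y b = F y b * E x a) (hψ : ‖ψ‖ = 1) {p : Density I O}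
    (hp : ∀ a b x y, (p a b x y : ℂ) = inner ℂ ψ ((E x a * F y b) ψ)) (hs : IsSynchronous p) :
    IsTracial t p := by
  have hEFψ := apply_eq_of_synchronous hE hF hEF (ψ := ψ) fun x a b hab => by
    rw [← hp, hs x a b hab, Complex.ofReal_zero]
  refine ⟨generatedAlgebra E, inferInstance, _, fun x a => ⟨E x a, mem_generatedAlgebra x a⟩,
    ht _, isTrace_vectorFunctional _ hψ fun X hX Y hY =>
      vectorFunctional_mul_comm hE hF hEF hEFψ hX hY, fun x => ?_, fun a b x y => ?_⟩
  · exact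
      { isStarProjection := fun a =>
          { isIdempotentElem := Subtype.ext ((hE x).isStarProjection a).isIdempotentElem.eq
            isSelfAdjoint := Subtype.ext ((hE x).isStarProjection a).isSelfAdjoint.star_eq }
        sum_eq_one := Subtype.ext (by simpa using (hE x).sum_eq_one) }
  · rw [hp, mul_apply_eq_comp, ← hEFψ]
    rfl

lemma isTracial_of_mem_commutingDensities {I O : Type*} [Fintype O] {p : Density I O}
    (hp : p ∈ commutingDensities I O) (hs : IsSynchronous p) : IsTracial .qc p := by
  obtain ⟨H, _, _, _, E, F, ψ, hE, hF, hEF, hψ, h⟩ := hp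
  exact isTracial_of_commuting .qc (fun _ _ => trivial) hE hF hEF hψ h hs

/-- The operators `E ⊗ 1` and `1 ⊗ F` form a commuting strategy on a finite dimensional space, where
every operator algebra is finite dimensional. -/
lemma isTracial_of_mem_quantumDensities {I O : Type*} [Fintype O] {p : Density I O}
    (hp : p ∈ quantumDensities I O) (hs : IsSynchronous p) : IsTracial .q p := by
  obtain ⟨m, k, E, F, ψ, hE, hF, hψ, h⟩ := hp
  let H := EuclideanSpace ℂ (Fin m × Fin k)
  let T := Matrix.toEuclideanCLM (n := Fin m × Fin k) (𝕜 := ℂ)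
  have hinner : ∀ M : Matrix (Fin m × Fin k) (Fin m × Fin k) ℂ,
      inner ℂ (WithLp.toLp 2 ψ : H) (T M (WithLp.toLp 2 ψ)) = star ψ ⬝ᵥ (M *ᵥ ψ) := fun M => by
    rw [Matrix.toEuclideanCLM_toLp, EuclideanSpace.inner_toLp_toLp, dotProduct_comm]
  have hl : ∀ x, IsPVM fun a => T (E x a ⊗ₖ (1 : Matrix (Fin k) (Fin k) ℂ)) := fun x =>
    IsPVM.map (E := fun a => E x a ⊗ₖ (1 : Matrix (Fin k) (Fin k) ℂ))
      { isStarProjection := fun a =>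
          { isIdempotentElem := by
              rw [IsIdempotentElem, ← Matrix.mul_kronecker_mul,
                ((hE x).isStarProjection a).isIdempotentElem.eq, one_mul]
            isSelfAdjoint := by
              rw [IsSelfAdjoint, Matrix.star_eq_conjTranspose, Matrix.conjTranspose_kronecker,
                Matrix.conjTranspose_one, ← Matrix.star_eq_conjTranspose,
                ((hE x).isStarProjection a).isSelfAdjoint.star_eq] }
        sum_eq_one := by
          rw [← Matrix.one_kronecker_one, ← (hE x).sum_eq_one]
          ext i j
          simp [Matrix.sum_apply, Finset.sum_mul] } T
  have hr : ∀ y, IsPVM fun b => T ((1 : Matrix (Fin m) (Fin m) ℂ) ⊗ₖ F y b) := fun y =>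
    IsPVM.map (E := fun b => (1 : Matrix (Fin m) (Fin m) ℂ) ⊗ₖ F y b)
      { isStarProjection := fun b =>
          { isIdempotentElem := by
              rw [IsIdempotentElem, ← Matrix.mul_kronecker_mul,
                ((hF y).isStarProjection b).isIdempotentElem.eq, one_mul]
            isSelfAdjoint := by
              rw [IsSelfAdjoint, Matrix.star_eq_conjTranspose, Matrix.conjTranspose_kronecker,
                Matrix.conjTranspose_one, ← Matrix.star_eq_conjTranspose,
                ((hF y).isStarProjection b).isSelfAdjoint.star_eq] }
        sum_eq_one := by
          rw [← Matrix.one_kronecker_one, ← (hF y).sum_eq_one]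
          ext i j
          simp [Matrix.sum_apply, Finset.mul_sum] } T
  refine isTracial_of_commuting (H := H) (ψ := WithLp.toLp 2 ψ) .q
    (fun S _ => inferInstanceAs (FiniteDimensional ℂ S.toSubalgebra)) hl hr
    (fun x y a b => ?_) ?_ (fun a b x y => ?_) hs
  · rw [← map_mul, ← map_mul, ← Matrix.mul_kronecker_mul, ← Matrix.mul_kronecker_mul, one_mul,
      mul_one, one_mul, mul_one]
  · have : ((‖(WithLp.toLp 2 ψ : H)‖ ^ 2 : ℝ) : ℂ) = 1 := by
      have := inner_self_eq_norm_sq_to_K (𝕜 := ℂ) (WithLp.toLp 2 ψ : H)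
      rw [EuclideanSpace.inner_toLp_toLp, dotProduct_comm, hψ] at this
      rw [this]
      simp
    have h2 : ‖(WithLp.toLp 2 ψ : H)‖ ^ 2 = 1 := by exact_mod_cast this
    exact (pow_eq_one_iff_of_nonneg (norm_nonneg _) two_ne_zero).mp h2
  · rw [h, ← map_mul, hinner, ← Matrix.mul_kronecker_mul, one_mul, mul_one]

/-! ### Local densities and abelian algebras -/

section Local

variable {I O A : Type*} [Fintype O] [CommCStarAlgebra A]

/-- Commuting projections have positive products, and the products of `E a` with the other outcomes
sum to zero. -/
lemma IsPVM.mul_eq_ite [DecidableEq O] {E : O → A} (hE : IsPVM E) (a b : O) :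
    E a * E b = if b = a then E b else 0 := by
  let _ := CStarAlgebra.spectralOrder A
  have _ := CStarAlgebra.spectralOrderedRing A
  split_ifs with h
  · rw [h, (hE.isStarProjection a).isIdempotentElem.eq]
  · have hs : ∑ d, E a * E d = E a * E a := by
      rw [← Finset.mul_sum, hE.sum_eq_one, mul_one, (hE.isStarProjection a).isIdempotentElem.eq]
    rw [← Finset.add_sum_erase _ _ (Finset.mem_univ a), add_eq_left,
      Finset.sum_eq_zero_iff_of_nonneg fun d _ =>
        ((hE.isStarProjection a).mul (hE.isStarProjection d) (Commute.all _ _)).nonneg] at hs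
    exact hs b (Finset.mem_erase.mpr ⟨h, Finset.mem_univ _⟩)

variable [Fintype I]

/-- The joint projection of the outcomes `f`. -/
noncomputable def jointProjection (E : I → O → A) (f : I → O) : A := ∏ x, E x (f x)

lemma isStarProjection_jointProjection {E : I → O → A} (hE : ∀ x, IsPVM (E x)) (f : I → O) :
    IsStarProjection (jointProjection E f) :=
  Finset.prod_induction _ _ (fun _ _ hp hq => hp.mul hq (Commute.all _ _)) (.one A)
    fun x _ => (hE x).isStarProjection (f x)

lemma sum_jointProjection [DecidableEq I] {E : I → O → A} (hE : ∀ x, IsPVM (E x)) :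
    ∑ f, jointProjection E f = 1 := by
  have := Finset.prod_univ_sum (fun _ : I => (Finset.univ : Finset O)) E
  rw [Fintype.piFinset_univ] at this
  simp only [jointProjection, ← this, (hE _).sum_eq_one, Finset.prod_const_one]

lemma mul_jointProjection [DecidableEq O] {E : I → O → A} (hE : ∀ x, IsPVM (E x))
    (f : I → O) (x : I) (a : O) :
    E x a * jointProjection E f = if f x = a then jointProjection E f else 0 := by
  classical
  rw [jointProjection, ← Finset.mul_prod_erase _ _ (Finset.mem_univ x), ← mul_assoc,
    (hE x).mul_eq_ite]
  split_ifs <;> simp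

/-- The traces of the joint projections form a probability distribution on functions `f`; both
players answer by the same random `f`. -/
lemma traceDensity_mem_localDensities_of_comm {τ : A →ₗ[ℂ] ℂ} {E : I → O → A} (hτ : IsTrace τ)
    (hE : ∀ x, IsPVM (E x)) : traceDensity τ E ∈ localDensities I O := by
  classical
  have hpos : ∀ f, 0 ≤ τ (jointProjection E f) := fun f => by
    simpa using hτ.mul_nonneg (isStarProjection_jointProjection hE f) (.one A)
  refine mem_convexHull_of_exists_fintype (fun f : I → O => (τ (jointProjection E f)).re)
    (fun f => deterministic f f) (fun f => (Complex.nonneg_iff.mp (hpos f)).1) ?_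
    (fun f => ⟨f, f, rfl⟩) ?_
  · rw [← Complex.re_sum, ← map_sum, sum_jointProjection hE, hτ.map_one, Complex.one_re]
  · funext a b x y
    have h : E x a * E y b =
        ∑ f, if f x = a ∧ f y = b then jointProjection E f else 0 := by
      rw [← mul_one (E x a * E y b), ← sum_jointProjection hE, Finset.mul_sum]
      refine Finset.sum_congr rfl fun f _ => ?_
      rw [mul_assoc, mul_jointProjection hE, mul_ite, mul_zero, mul_jointProjection hE]
      split_ifs <;> simp_all
    simp only [Finset.sum_apply, Pi.smul_apply, traceDensity, h, map_sum, Complex.re_sum]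
    refine Finset.sum_congr rfl fun f _ => ?_
    simp only [deterministic, smul_eq_mul, mul_ite, mul_one, mul_zero]
    split_ifs <;> simp

end Local

/-- Traces on abelian C*-algebras give local densities. -/
lemma traceDensity_mem_localDensities {I O A : Type*} [Fintype I] [Fintype O] [CStarAlgebra A]
    (hA : ∀ a b : A, a * b = b * a) {τ : A →ₗ[ℂ] ℂ} {E : I → O → A} (hτ : IsTrace τ)
    (hE : ∀ x, IsPVM (E x)) : traceDensity τ E ∈ localDensities I O :=
  let _ : CommCStarAlgebra A := { ‹CStarAlgebra A› with mul_comm := hA }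
  traceDensity_mem_localDensities_of_comm hτ hE

/-- The trace on `ι → ℂ` given by a probability vector. -/
noncomputable def weightedSum {ι : Type*} [Fintype ι] (w : ι → ℝ) : (ι → ℂ) →ₗ[ℂ] ℂ where
  toFun h := ∑ i, (w i : ℂ) * h i
  map_add' _ _ := by simp [mul_add, Finset.sum_add_distrib]
  map_smul' _ _ := by simp [Finset.mul_sum, mul_left_comm]

lemma isTrace_weightedSum {ι : Type*} [Fintype ι] {w : ι → ℝ} (hw : ∀ i, 0 ≤ w i)
    (hw1 : ∑ i, w i = 1) : IsTrace (weightedSum w) where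
  map_one := by
    simp only [weightedSum, LinearMap.coe_mk, AddHom.coe_mk, Pi.one_apply, mul_one]
    exact_mod_cast hw1
  nonneg a := Finset.sum_nonneg fun i _ =>
    mul_nonneg (by exact_mod_cast hw i) (star_mul_self_nonneg (a i))
  mul_comm a b := by rw [mul_comm]

/-- The PVMs in `ι → ℂ` of a family of random functions. -/
noncomputable def randomPVM {ι I O : Type*} (f : ι → I → O) : I → O → (ι → ℂ) :=
  open Classical in fun x a i => if f i x = a then 1 else 0

lemma isPVM_randomPVM {ι I O : Type*} [Fintype O] (f : ι → I → O) (x : I) :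
    IsPVM (randomPVM f x) where
  isStarProjection a :=
    { isIdempotentElem := by ext i; simp [randomPVM]
      isSelfAdjoint := by ext i; simp [randomPVM, apply_ite] }
  sum_eq_one := by classical ext i; simp [randomPVM, Finset.sum_apply]

lemma isTracial_of_mem_localDensities {I O : Type*} [Fintype O] {p : Density I O}
    (hp : p ∈ localDensities I O) (hs : IsSynchronous p) : IsTracial .loc p := by
  classical
  obtain ⟨ι, _, w, z, hw, hw1, hz, rfl⟩ := mem_convexHull_iff_exists_fintype.mp hp
  choose f g hfg using hz
  have hval : ∀ a b x y, (∑ i, w i • z i) a b x y =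
      ∑ i, w i * if f i x = a ∧ g i y = b then 1 else 0 := fun a b x y => by
    simp [Finset.sum_apply, hfg, deterministic]
  -- A question on which `f i` and `g i` differ would contribute `w i` to a synchronously forbidden
  -- probability.
  have heq : ∀ i, w i ≠ 0 → f i = g i := fun i hi => by
    by_contra hne
    obtain ⟨x, hx⟩ := Function.ne_iff.mp hne
    have h0 := hs x (f i x) (g i x) hx
    rw [hval, Finset.sum_eq_zero_iff_of_nonneg fun j _ =>
      mul_nonneg (hw j) (by split_ifs <;> norm_num)] at h0
    have := h0 i (Finset.mem_univ i)
    simp_all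
  refine ⟨ι → ℂ, inferInstance, weightedSum w, randomPVM f, fun a b => mul_comm a b,
    isTrace_weightedSum hw hw1, isPVM_randomPVM f, fun a b x y => ?_⟩
  rw [hval]
  simp only [weightedSum, randomPVM, LinearMap.coe_mk, AddHom.coe_mk, Pi.mul_apply]
  push_cast
  refine Finset.sum_congr rfl fun i _ => ?_
  by_cases hi : w i = 0
  · simp [hi]
  · rw [heq i hi]
    split_ifs <;> simp_all

/-! ### The correspondence for all types -/

theorem isTracial_of_mem_syncDensities {I O : Type*} [Fintype O] {t : StrategyType}
    {p : Density I O} (hp : p ∈ syncDensities t I O) : IsTracial t p := by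
  obtain ⟨hp, hs⟩ := hp
  cases t with
  | loc => exact isTracial_of_mem_localDensities hp hs
  | q => exact isTracial_of_mem_quantumDensities hp hs
  | qc => exact isTracial_of_mem_commutingDensities hp hs

theorem traceDensity_mem_syncDensities {I O : Type*} [Fintype I] [Fintype O] {t : StrategyType}
    {A : Type} [CStarAlgebra A] (hA : AlgebraOfType t A) {τ : A →ₗ[ℂ] ℂ} {E : I → O → A}
    (hτ : IsTrace τ) (hE : ∀ x, IsPVM (E x)) : traceDensity τ E ∈ syncDensities t I O := by
  refine ⟨?_, hτ.isSynchronous_traceDensity hE⟩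
  cases t with
  | loc => exact traceDensity_mem_localDensities hA hτ hE
  | q =>
    have : FiniteDimensional ℂ A := hA
    exact traceDensity_mem_quantumDensities hτ hE
  | qc => exact traceDensity_mem_commutingDensities hτ hE

/-! ### The colouring game -/

section Colouring

variable {V : Type*} [Fintype V] {G : SimpleGraph V} {c : ℕ} {t : StrategyType}

lemma mem_edgePairs {e : V × V} : e ∈ edgePairs G ↔ G.Adj e.1 e.2 := by
  simp [edgePairs]

/-- The sum over all edges of the probabilities of losing. -/
noncomputable def lossSum (G : SimpleGraph V) (p : Density V (Fin c)) : ℝ :=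
  ∑ e ∈ edgePairs G, ∑ a, p a a e.1 e.2

lemma expectedValue_colouringGame (hE : (edgePairs G).Nonempty) {p : Density V (Fin c)}
    (hp : ∀ x y, ∑ a, ∑ b, p a b x y = 1) :
    expectedValue (colouringGame G c) (uniformOnEdges G) p =
      1 - 1 / ((edgePairs G).card : ℝ) * lossSum G p := by
  classical
  have hcard : ((edgePairs G).card : ℝ) ≠ 0 := by simpa using hE.ne_empty
  have hxy : ∀ e : V × V, (∑ a, ∑ b, uniformOnEdges G e.1 e.2 *
      (if (colouringGame G c).win e.1 e.2 a b then 1 else 0) * p a b e.1 e.2) =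
      if e ∈ edgePairs G then
        1 / ((edgePairs G).card : ℝ) * (1 - ∑ a, p a a e.1 e.2) else 0 := by
    intro e
    split_ifs with he
    · have hadj := mem_edgePairs.mp he
      have hne : e.1 ≠ e.2 := hadj.ne
      -- Adjacent vertices are distinct, so the synchronicity rule never applies on an edge.
      have hwin : ∀ a b, (colouringGame G c).win e.1 e.2 a b ↔ a ≠ b := fun a b => by
        simp [colouringGame, homGame, hadj, hne]
      have hu : uniformOnEdges G e.1 e.2 = 1 / ((edgePairs G).card : ℝ) := by
        simp [uniformOnEdges, he]
      have hl : 1 - ∑ a, p a a e.1 e.2 =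
          ∑ a, ∑ b, (p a b e.1 e.2 - if a = b then p a b e.1 e.2 else 0) := by
        simp [Finset.sum_sub_distrib, hp]
      rw [hl, Finset.mul_sum]
      refine Finset.sum_congr rfl fun a _ => ?_
      rw [Finset.mul_sum]
      refine Finset.sum_congr rfl fun b _ => ?_
      rw [hu, mul_assoc]
      congr 1
      by_cases hab : a = b <;> simp [hwin, hab]
    · have hu : uniformOnEdges G e.1 e.2 = 0 := by simp [uniformOnEdges, he]
      simp [hu]
  have hcalc : expectedValue (colouringGame G c) (uniformOnEdges G) p =
      ∑ e ∈ edgePairs G, 1 / ((edgePairs G).card : ℝ) * (1 - ∑ a, p a a e.1 e.2) := by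
    rw [expectedValue, ← Fintype.sum_prod_type']
    simp only [hxy, Finset.sum_ite_mem, Finset.univ_inter]
  rw [hcalc, ← Finset.mul_sum, Finset.sum_sub_distrib, Finset.sum_const, nsmul_eq_mul, mul_one,
    mul_sub, one_div_mul_cancel hcard, lossSum]

lemma IsTracial.sum_eq_one {I O : Type*} [Fintype O] {p : Density I O} (hp : IsTracial t p)
    (x y : I) : ∑ a, ∑ b, p a b x y = 1 := by
  obtain ⟨A, _, τ, E, -, hτ, hE, h⟩ := hp
  have : ((∑ a, ∑ b, p a b x y : ℝ) : ℂ) = 1 := by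
    push_cast
    simp_rw [h, ← map_sum, ← Finset.mul_sum, ← Finset.sum_mul, (hE _).sum_eq_one, one_mul,
      hτ.map_one]
  exact_mod_cast this

/-- The average of a trace over finitely many copies of the algebra. -/
noncomputable def averageTrace {A : Type*} [CStarAlgebra A] (c : ℕ) (τ : A →ₗ[ℂ] ℂ) :
    (Fin c → A) →ₗ[ℂ] ℂ :=
  (c : ℂ)⁻¹ • ∑ i, τ ∘ₗ LinearMap.proj i

lemma averageTrace_apply {A : Type*} [CStarAlgebra A] (τ : A →ₗ[ℂ] ℂ) (h : Fin c → A) :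
    averageTrace c τ h = (c : ℂ)⁻¹ * ∑ i, τ (h i) := by
  simp [averageTrace]

lemma IsTrace.average {A : Type*} [CStarAlgebra A] {τ : A →ₗ[ℂ] ℂ} (hτ : IsTrace τ)
    (hc : c ≠ 0) : IsTrace (averageTrace c τ) where
  map_one := by simp [averageTrace_apply, hτ.map_one, hc]
  nonneg h := by
    rw [averageTrace_apply]
    refine _root_.mul_nonneg ?_ (Finset.sum_nonneg fun i _ => hτ.nonneg (h i))
    rw [← Complex.ofReal_natCast, ← Complex.ofReal_inv]
    exact_mod_cast inv_nonneg.mpr (Nat.cast_nonneg c)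
  mul_comm h k := by simp [averageTrace_apply, hτ.mul_comm]

lemma AlgebraOfType.pi {A : Type*} [CStarAlgebra A] (hA : AlgebraOfType t A) (c : ℕ) :
    AlgebraOfType t (Fin c → A) := by
  cases t with
  | loc => exact fun a b => funext fun i => hA (a i) (b i)
  | q =>
    have : FiniteDimensional ℂ A := hA
    exact inferInstanceAs (FiniteDimensional ℂ (Fin c → A))
  | qc => trivial

/-- Averaging the projections of a strategy over the colours. -/
lemma IsTracial.lossSum_mem_correlationSet (hc : c ≠ 0) {p : Density V (Fin c)}
    (hp : IsTracial t p) : 1 / (c : ℝ) * lossSum G p ∈ correlationSet G t (1 / c) := by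
  obtain ⟨A, _, τ, E, hA, hτ, hE, h⟩ := hp
  -- The tuple `E x`, read as one element of `Fin c → A`, is the required projection.
  refine ⟨Fin c → A, inferInstance, averageTrace c τ, E, hA.pi c, hτ.average hc, fun x => ?_,
    fun x => ?_, ?_⟩
  · exact
      { isIdempotentElem := funext fun a => ((hE x).isStarProjection a).isIdempotentElem.eq
        isSelfAdjoint := funext fun a => ((hE x).isStarProjection a).isSelfAdjoint.star_eq }
  · simp [averageTrace_apply, ← map_sum, (hE x).sum_eq_one, hτ.map_one]
  · simp [averageTrace_apply, lossSum, h, Finset.mul_sum]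

/-- Projections of trace one half are strategies using two colours. -/
lemma exists_lossSum_eq (hc : 2 ≤ c) {s : ℝ} (hs : s ∈ correlationSet G t (1 / 2)) :
    ∃ p ∈ syncDensities t V (Fin c), lossSum G p = 2 * s := by
  obtain ⟨n, rfl⟩ := Nat.exists_eq_add_of_le' hc
  obtain ⟨A, _, τ, P, hA, hτ, hP, hr, hs⟩ := hs
  let E : V → Fin (n + 2) → A := fun x => Fin.cons (P x) (Fin.cons (1 - P x) fun _ => 0)
  have hE : ∀ x, IsPVM (E x) := fun x =>
    { isStarProjection := by
        refine Fin.cases (hP x) (Fin.cases (hP x).one_sub fun _ => .zero A)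
      sum_eq_one := by simp [E, Fin.sum_univ_succ] }
  refine ⟨traceDensity τ E, traceDensity_mem_syncDensities hA hτ hE, ?_⟩
  have h : ((lossSum G (traceDensity τ E) : ℝ) : ℂ) = ((2 * s : ℝ) : ℂ) := by
    push_cast [lossSum]
    rw [hs, Finset.mul_sum]
    refine Finset.sum_congr rfl fun e _ => ?_
    simp only [hτ.coe_traceDensity hE, E, Fin.sum_univ_succ, Fin.cons_zero, Fin.cons_succ]
    -- The second colour contributes `1 - 1/2 - 1/2 + τ (P x * P y)`, the same as the first; this is
    -- where trace 1/2 is used.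
    simp only [mul_zero, map_zero, Finset.sum_const_zero, add_zero, mul_sub, sub_mul, mul_one,
      one_mul, map_sub, hr, hτ.map_one]
    push_cast
    ring
  exact_mod_cast h

/-- The density of the colouring `f`. -/
lemma deterministic_mem_syncDensities {I O : Type*} [Fintype I] [Fintype O] (f : I → O) :
    deterministic f f ∈ syncDensities t I O := by
  -- The algebra of a one-point probability space is of every type.
  have hτ : IsTrace (weightedSum fun _ : Fin 1 => (1 : ℝ)) :=
    isTrace_weightedSum (fun _ => zero_le_one) (by simp)
  have hA : AlgebraOfType t (Fin 1 → ℂ) := by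
    cases t with
    | loc => exact fun a b => mul_comm a b
    | q => exact inferInstanceAs (FiniteDimensional ℂ (Fin 1 → ℂ))
    | qc => trivial
  convert traceDensity_mem_syncDensities hA hτ (isPVM_randomPVM fun _ : Fin 1 => f) using 1
  funext a b x y
  by_cases h1 : f x = a <;> by_cases h2 : f y = b <;>
    simp [traceDensity, weightedSum, randomPVM, deterministic, h1, h2]

lemma lossSum_deterministic (f : V → Fin c) :
    lossSum G (deterministic f f) = ∑ e ∈ edgePairs G, if f e.1 = f e.2 then 1 else 0 := by
  classical
  refine Finset.sum_congr rfl fun e _ => ?_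
  split_ifs with h
  · simp [deterministic, h]
  · refine Finset.sum_eq_zero fun a _ => ?_
    simp only [deterministic, ite_eq_right_iff, one_ne_zero, imp_false, not_and]
    rintro rfl h'
    exact h h'.symm

/-- A uniformly random colouring gives two distinct vertices the same colour with
probability `1 / c`. -/
lemma sum_ite_eq_card [DecidableEq V] {x y : V} (hxy : x ≠ y) :
    (c : ℝ) * ∑ f : V → Fin c, (if f x = f y then 1 else 0) = (Fintype.card (V → Fin c) : ℝ) := by
  -- Once the colours off `x` are fixed, exactly one colour of `x` matches that of `y`.
  let e := Equiv.funSplitAt x (Fin c)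
  have h1 : ∑ f : V → Fin c, (if f x = f y then (1 : ℝ) else 0) =
      ∑ g : Fin c × ({j // j ≠ x} → Fin c), if g.1 = g.2 ⟨y, hxy.symm⟩ then 1 else 0 :=
    Fintype.sum_equiv e _ _ fun f => rfl
  rw [h1, Fintype.card_congr e, Fintype.sum_prod_type_right]
  simp

/-- Some colouring does at least as well as the uniformly random one. The witness also shows that
the sets behind the supremum and the infimum are nonempty. -/
lemma exists_lossSum_le (hc : 2 ≤ c) :
    ∃ p ∈ syncDensities t V (Fin c), (c : ℝ) * lossSum G p ≤ (edgePairs G).card := by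
  classical
  have : NeZero c := ⟨by omega⟩
  have hsum : ∑ f : V → Fin c, (c : ℝ) * lossSum G (deterministic f f) ≤
      ∑ f : V → Fin c, ((edgePairs G).card : ℝ) := by
    refine le_of_eq ?_
    simp_rw [lossSum_deterministic]
    rw [← Finset.mul_sum, Finset.sum_comm, Finset.mul_sum,
      Finset.sum_congr rfl fun e he => sum_ite_eq_card (mem_edgePairs.mp he).ne]
    simp [mul_comm]
  obtain ⟨f, -, hf⟩ := Finset.exists_le_of_sum_le Finset.univ_nonempty hsum
  exact ⟨_, deterministic_mem_syncDensities f, hf⟩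

/-! ### Passing to suprema and infima -/

lemma correlationSet_bddBelow (r : ℝ) : BddBelow (correlationSet G t r) := by
  refine ⟨0, ?_⟩
  rintro s ⟨A, _, τ, P, -, hτ, hP, -, hs⟩
  have : (0 : ℂ) ≤ s := hs ▸ Finset.sum_nonneg fun e _ => hτ.mul_nonneg (hP _) (hP _)
  exact_mod_cast this

lemma correlationSet_nonempty (hc : 2 ≤ c) : (correlationSet G t (1 / c)).Nonempty := by
  obtain ⟨p, hp, -⟩ := exists_lossSum_le (G := G) (t := t) hc
  exact ⟨_, (isTracial_of_mem_syncDensities hp).lossSum_mem_correlationSet (by omega)⟩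

lemma expectedValue_of_mem (hE : (edgePairs G).Nonempty) {p : Density V (Fin c)} (hp : p ∈ syncDensities t V (Fin c)) :
    expectedValue (colouringGame G c) (uniformOnEdges G) p =
      1 - 1 / ((edgePairs G).card : ℝ) * lossSum G p :=
  expectedValue_colouringGame hE (isTracial_of_mem_syncDensities hp).sum_eq_one

lemma expectedValue_le (hE : (edgePairs G).Nonempty) (hc : 2 ≤ c) {p : Density V (Fin c)}
    (hp : p ∈ syncDensities t V (Fin c)) :
    expectedValue (colouringGame G c) (uniformOnEdges G) p ≤
      1 - (c : ℝ) / ((edgePairs G).card : ℝ) * graphCorrelation G t (1 / c) := by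
  have hc0 : (c : ℝ) ≠ 0 := Nat.cast_ne_zero.mpr (by omega)
  have h : graphCorrelation G t (1 / c) ≤ 1 / (c : ℝ) * lossSum G p :=
    csInf_le (correlationSet_bddBelow _)
      ((isTracial_of_mem_syncDensities hp).lossSum_mem_correlationSet (by omega))
  have h' := mul_le_mul_of_nonneg_left h
    (show 0 ≤ (c : ℝ) / ((edgePairs G).card : ℝ) by positivity)
  rw [expectedValue_of_mem hE hp]
  calc 1 - 1 / ((edgePairs G).card : ℝ) * lossSum G p
      = 1 - (c : ℝ) / ((edgePairs G).card : ℝ) * (1 / (c : ℝ) * lossSum G p) := by field_simp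
    _ ≤ _ := sub_le_sub_left h' 1

lemma le_syncValue (hE : (edgePairs G).Nonempty) (hc : 2 ≤ c) {p : Density V (Fin c)}
    (hp : p ∈ syncDensities t V (Fin c)) :
    1 - 1 / ((edgePairs G).card : ℝ) * lossSum G p ≤
      syncValue t (colouringGame G c) (uniformOnEdges G) := by
  rw [← expectedValue_of_mem hE hp]
  have hb : BddAbove (expectedValue (colouringGame G c) (uniformOnEdges G) ''
      syncDensities t V (Fin c)) := by
    refine ⟨1 - (c : ℝ) / ((edgePairs G).card : ℝ) * graphCorrelation G t (1 / c), ?_⟩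
    rintro _ ⟨q, hq, rfl⟩
    exact expectedValue_le hE hc hq
  exact le_csSup hb ⟨p, hp, rfl⟩

lemma syncValue_le (hE : (edgePairs G).Nonempty) (hc : 2 ≤ c) :
    syncValue t (colouringGame G c) (uniformOnEdges G) ≤
      1 - (c : ℝ) / ((edgePairs G).card : ℝ) * graphCorrelation G t (1 / c) := by
  obtain ⟨p, hp, -⟩ := exists_lossSum_le (G := G) (t := t) hc
  refine csSup_le ⟨_, p, hp, rfl⟩ ?_
  rintro _ ⟨q, hq, rfl⟩
  exact expectedValue_le hE hc hq

lemma one_sub_inv_le_syncValue (hE : (edgePairs G).Nonempty) (hc : 2 ≤ c) :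
    1 - 1 / (c : ℝ) ≤ syncValue t (colouringGame G c) (uniformOnEdges G) := by
  obtain ⟨p, hp, h⟩ := exists_lossSum_le (G := G) (t := t) hc
  have hcard : 0 < ((edgePairs G).card : ℝ) := Nat.cast_pos.mpr hE.card_pos
  have hc0 : 0 < (c : ℝ) := Nat.cast_pos.mpr (by omega)
  refine le_trans (sub_le_sub_left ?_ 1) (le_syncValue hE hc hp)
  rw [one_div_mul_eq_div, div_le_div_iff₀ hcard hc0]
  linarith

lemma one_sub_graphCorrelation_half_le_syncValue (hE : (edgePairs G).Nonempty) (hc : 2 ≤ c) :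
    1 - 2 / ((edgePairs G).card : ℝ) * graphCorrelation G t (1 / 2) ≤
      syncValue t (colouringGame G c) (uniformOnEdges G) := by
  have hcard : 0 < ((edgePairs G).card : ℝ) := Nat.cast_pos.mpr hE.card_pos
  -- The level 1/2 is the case of two colours, whatever `c` is.
  have hne : (correlationSet G t (1 / 2)).Nonempty := by
    simpa using correlationSet_nonempty (G := G) (t := t) le_rfl
  -- The bound is solved for the correlation, so that it passes to the infimum without the infimum
  -- being attained.
  have h : (1 - syncValue t (colouringGame G c) (uniformOnEdges G)) *
      ((edgePairs G).card / 2) ≤ graphCorrelation G t (1 / 2) := by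
    refine le_csInf hne fun s hs => ?_
    obtain ⟨p, hp, hps⟩ := exists_lossSum_eq hc hs
    have := le_syncValue hE hc hp
    rw [hps, sub_le_comm, one_div_mul_eq_div, le_div_iff₀ hcard] at this
    linarith
  rw [sub_le_comm, div_mul_eq_mul_div, le_div_iff₀ hcard]
  linarith

end Colouring

end SyncGame

theorem mainTheorem8 {V : Type*} [Fintype V] (G : SimpleGraph V)
    (hE : (SyncGame.edgePairs G).Nonempty) (c : ℕ) (hc : 2 ≤ c) (t : SyncGame.StrategyType) :
    max (1 - 1 / (c : ℝ))
        (1 - 2 / ((SyncGame.edgePairs G).card : ℝ) * SyncGame.graphCorrelation G t (1 / 2))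
      ≤ SyncGame.syncValue t (SyncGame.colouringGame G c) (SyncGame.uniformOnEdges G) ∧
    SyncGame.syncValue t (SyncGame.colouringGame G c) (SyncGame.uniformOnEdges G)
      ≤ 1 - (c : ℝ) / ((SyncGame.edgePairs G).card : ℝ) *
          SyncGame.graphCorrelation G t (1 / (c : ℝ)) ∧
    (c = 2 →
      SyncGame.syncValue t (SyncGame.colouringGame G c) (SyncGame.uniformOnEdges G)
        = 1 - 2 / ((SyncGame.edgePairs G).card : ℝ) *
            SyncGame.graphCorrelation G t (1 / 2)) := by
  refine ⟨max_le (SyncGame.one_sub_inv_le_syncValue hE hc)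
    (SyncGame.one_sub_graphCorrelation_half_le_syncValue hE hc), SyncGame.syncValue_le hE hc, ?_⟩
  rintro rfl
  refine le_antisymm ?_ (SyncGame.one_sub_graphCorrelation_half_le_syncValue hE hc)
  exact_mod_cast SyncGame.syncValue_le (t := t) hE hc
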